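/- Terminology. A category is *Cartesian* if it has finite limits; a functor is Cartesian if it preserves finite limits, and a comonad is Cartesian if its underlying functor is. A *Heyting category* is a regular category in which the subobjects of each object have finite unions, these are preserved by pullback along every morphism, and each pullback operation $f^*:\mathrm{Sub}(Y)\to\mathrm{Sub}(X)$ has a right adjoint $\forall_f$. A *Heyting functor* is a functor preserving finite limits, regular epimorphisms (hence images), finite unions of subobjects and the operations $\forall_f$. A monomorphism $t$ is *generic* if every monomorphism is a pullback of $t$ (along a not necessarily unique morphism). A *Cartesian full subcategory inclusion* is a full and faithful functor, injective on objects, which preserves finite limits; between Heyting categories that admit a generic mono it is a *logical inclusion* if it is moreover a Heyting functor and preserves generic monos. A functor $F:\mathbf{C}\to\mathbf{D}$ is *dense* if each object $D$ of $\mathbf{D}$ is, canonically, the colimit of $F\downarrow D\to\mathbf{C}\xrightarrow{F}\mathbf{D}$. Let $\Box_\mathbf{C}:\mathbf{C}\to\mathbf{C}$ and $\Box_\mathbf{D}:\mathbf{D}\to\mathbf{D}$ be Cartesian comonads. A *Cartesian full inclusion* $i:\Box_\mathbf{C}\hookrightarrow\Box_\mathbf{D}$ is a Cartesian full subcategory inclusion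 $i:\mathbf{C}\hookrightarrow\mathbf{D}$ with $i\,\Box_\mathbf{C}=\Box_\mathbf{D}\,i$, compatibly with counits and comultiplications (a strict morphism of comonads). It is *logical* if $i:\mathbf{C}\hookrightarrow\mathbf{D}$ is a logical inclusion. It is *dense* if $i:\mathbf{C}\hookrightarrow\mathbf{D}$ is a dense functor and, for all $X\in\mathbf{D}$ and $A\in\mathbf{C}$, every morphism $iA\to\Box_\mathbf{D}X$ of $\mathbf{D}$ factors through $\Box_\mathbf{D}g$ for some $B\in\mathbf{C}$ and $g:iB\to X$. Write $\mathbf{C}^{\Box_\mathbf{C}}$ and $\mathbf{D}^{\Box_\mathbf{D}}$ for the categories of coalgebras. Theorem. Let $\mathbf{C}$ and $\mathbf{D}$ each be a Heyting category that admits a generic mono, let $\Box_\mathbf{C}$ and $\Box_\mathbf{D}$ be Cartesian comonads on $\mathbf{C}$ and $\mathbf{D}$, and let $i:\Box_\mathbf{C}\hookrightarrow\Box_\mathbf{D}$ be a dense Cartesian full inclusion of Cartesian comonads which is moreover logical. Then $\mathbf{C}^{\Box_\mathbf{C}}$ and $\mathbf{D}^{\Box_\mathbf{D}}$ are each a Heyting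 category that admits a generic mono, and the functor $\mathbf{C}^{\Box_\mathbf{C}}\to\mathbf{D}^{\Box_\mathbf{D}}$ induced by $i$ is a Cartesian full subcategory inclusion which is dense and a logical inclusion. -/

import Mathlib

open CategoryTheory CategoryTheory.Limits

universe v₁ v₂ v₃ v₄ u₁ u₂ u₃ u₄

namespace CoalgebraLifting

/-! ### Heyting categories and Heyting functors -/

section Heyting

/-- `R` is the universal image `∀_f S` of the subobject `S` along `f`: it is the value at `S` of
a right adjoint to pulling back subobjects along `f`. -/
def IsForall {C : Type u₁} [Category.{v₁} C] [HasPullbacks C] {X Y : C} (f : X ⟶ Y)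
    (S : Subobject X) (R : Subobject Y) : Prop :=
  ∀ T : Subobject Y, (Subobject.pullback f).obj T ≤ S ↔ T ≤ R

/-- A Heyting category: a regular category in which subobject posets have finite unions that are
stable under pullback (that is, a coherent category), and in which every operation of pulling
subobjects back along a morphism has a right adjoint. -/
class HeytingCategory (C : Type u₁) [Category.{v₁} C] : Prop extends Regular C where
  exists_isBot (X : C) : ∃ S : Subobject X, IsBot S
  pullback_isBot {X Y : C} (f : X ⟶ Y) (S : Subobject Y) :
    IsBot S → IsBot ((Subobject.pullback f).obj S)
  exists_isLUB {X : C} (S T : Subobject X) : ∃ U : Subobject X, IsLUB {S, T} U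
  pullback_isLUB {X Y : C} (f : X ⟶ Y) (S T U : Subobject Y) :
    IsLUB {S, T} U →
      IsLUB {(Subobject.pullback f).obj S, (Subobject.pullback f).obj T}
        ((Subobject.pullback f).obj U)
  exists_isForall {X Y : C} (f : X ⟶ Y) (S : Subobject X) : ∃ R : Subobject Y, IsForall f S R

/-- The image of a subobject under a functor that preserves finite limits. -/
noncomputable def mapSubobject {C : Type u₁} [Category.{v₁} C] {D : Type u₂} [Category.{v₂} D]
    (F : C ⥤ D) [PreservesFiniteLimits F] {X : C} (S : Subobject X) : Subobject (F.obj X) :=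
  Subobject.mk (F.map S.arrow)

/-- A Heyting functor: it preserves finite limits, regular epimorphisms (hence images), finite
unions of subobjects, and universal images of subobjects. -/
class IsHeytingFunctor {C : Type u₁} [Category.{v₁} C] {D : Type u₂} [Category.{v₂} D]
    [HeytingCategory C] [HeytingCategory D] (F : C ⥤ D) : Prop
    extends PreservesFiniteLimits F where
  map_isRegularEpi {X Y : C} (f : X ⟶ Y) : IsRegularEpi f → IsRegularEpi (F.map f)
  map_isBot {X : C} (S : Subobject X) : IsBot S → IsBot (mapSubobject F S)
  map_isLUB {X : C} (S T U : Subobject X) :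
    IsLUB {S, T} U → IsLUB {mapSubobject F S, mapSubobject F T} (mapSubobject F U)
  map_isForall {X Y : C} (f : X ⟶ Y) (S : Subobject X) (R : Subobject Y) :
    IsForall f S R → IsForall (F.map f) (mapSubobject F S) (mapSubobject F R)

end Heyting

/-! ### Generic monomorphisms -/

section GenericMono

/-- A monomorphism `t` is generic if every monomorphism is a pullback of it (along a morphism that
need not be unique). -/
def IsGenericMono {C : Type u₁} [Category.{v₁} C] {T Ω : C} (t : T ⟶ Ω) : Prop :=
  Mono t ∧ ∀ ⦃A B : C⦄ (m : A ⟶ B), Mono m →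
    ∃ (a : A ⟶ T) (χ : B ⟶ Ω), IsPullback a m t χ

/-- The category has a generic monomorphism. -/
def AdmitsGenericMono (C : Type u₁) [Category.{v₁} C] : Prop :=
  ∃ (T Ω : C) (t : T ⟶ Ω), IsGenericMono t

end GenericMono

/-! ### Inclusions of categories -/

section Inclusions

/-- A Cartesian full subcategory inclusion: a functor that is full, faithful and injective on
objects, and preserves finite limits. -/
structure IsCartesianFullInclusion {C : Type u₁} [Category.{v₁} C] {D : Type u₂} [Category.{v₂} D]
    (i : C ⥤ D) : Prop where
  full : i.Full
  faithful : i.Faithful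
  injective_obj : Function.Injective i.obj
  preservesFiniteLimits : PreservesFiniteLimits i

/-- A logical inclusion: a Cartesian full subcategory inclusion that is a Heyting functor and
preserves generic monomorphisms. -/
structure IsLogicalInclusion {C : Type u₁} [Category.{v₁} C] {D : Type u₂} [Category.{v₂} D]
    [HeytingCategory C] [HeytingCategory D] (i : C ⥤ D) : Prop
    extends IsCartesianFullInclusion i where
  isHeytingFunctor : IsHeytingFunctor i
  map_isGenericMono ⦃T Ω : C⦄ (t : T ⟶ Ω) : IsGenericMono t → IsGenericMono (i.map t)

/-- For inclusions `i : C ⥤ D` and `j : E ⥤ F` of full subcategories, the functor `G : D ⥤ F` is a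
morphism of sites `(D, C) ⟶ (F, E)` if every morphism to `G X` from an object of `E` factors
through `G g` for some morphism `g` to `X` from an object of `C`. -/
def IsMorphismOfSites {C : Type u₁} [Category.{v₁} C] {D : Type u₂} [Category.{v₂} D]
    {E : Type u₃} [Category.{v₃} E] {F : Type u₄} [Category.{v₄} F]
    (i : C ⥤ D) (j : E ⥤ F) (G : D ⥤ F) : Prop :=
  ∀ ⦃X : D⦄ ⦃A : E⦄ (f : j.obj A ⟶ G.obj X),
    ∃ (B : C) (g : i.obj B ⟶ X) (h : j.obj A ⟶ G.obj (i.obj B)), h ≫ G.map g = f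

end Inclusions

/-! ### Morphisms of comonads and the induced functors on coalgebras -/

/-- A morphism from a comonad `G` on `C` to a comonad `H` on `D`: a functor `C ⥤ D` with a natural
transformation that is compatible with counits and comultiplications. -/
structure ComonadMorphism {C : Type u₁} [Category.{v₁} C] {D : Type u₂} [Category.{v₂} D]
    (G : Comonad C) (H : Comonad D) where
  functor : C ⥤ D
  τ : G.toFunctor ⋙ functor ⟶ functor ⋙ H.toFunctor
  counit (X : C) : τ.app X ≫ H.ε.app (functor.obj X) = functor.map (G.ε.app X)
  comul (X : C) : τ.app X ≫ H.δ.app (functor.obj X) =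
    functor.map (G.δ.app X) ≫ τ.app (G.obj X) ≫ H.map (τ.app X)

namespace ComonadMorphism

section

variable {C : Type u₁} [Category.{v₁} C] {D : Type u₂} [Category.{v₂} D]
  {G : Comonad C} {H : Comonad D}

/-- The functor on categories of coalgebras induced by a morphism of comonads; it sends `(A, a)`
to `(i A, τ ∘ i a)`. -/
def coalg (i : ComonadMorphism G H) : G.Coalgebra ⥤ H.Coalgebra where
  obj A :=
    { A := i.functor.obj A.A
      a := i.functor.map A.a ≫ i.τ.app A.A
      counit := by
        rw [Category.assoc, i.counit, ← Functor.map_comp, A.counit, CategoryTheory.Functor.map_id]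
      coassoc := by
        have h := i.τ.naturality A.a
        simp only [Functor.comp_map] at h
        rw [Category.assoc, i.comul, ← Functor.map_comp_assoc, A.coassoc, Functor.map_comp_assoc,
          reassoc_of% h, Functor.map_comp, Category.assoc] }
  map {A B} f :=
    { f := i.functor.map f.f
      h := by
        have h := i.τ.naturality f.f
        simp only [Functor.comp_map] at h
        dsimp only
        rw [Category.assoc, ← h, ← Functor.map_comp_assoc, f.h, Functor.map_comp_assoc] }

/-- A morphism of comonads is strict if its natural transformation is an identity. -/
def IsStrict (i : ComonadMorphism G H) : Prop :=
  ∃ h : G.toFunctor ⋙ i.functor = i.functor ⋙ H.toFunctor, i.τ = eqToHom h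

/-- A Cartesian full inclusion of comonads: a strict morphism of comonads whose underlying functor
is a Cartesian full subcategory inclusion. -/
structure IsCartesianFullInclusion (i : ComonadMorphism G H) : Prop where
  isStrict : i.IsStrict
  functor : CoalgebraLifting.IsCartesianFullInclusion i.functor

/-- A Cartesian full inclusion of comonads is dense if the underlying functor `C ⥤ D` is dense and
the comonad on `D` is a morphism of sites `(D, C) ⟶ (D, C)`. -/
structure IsDense (i : ComonadMorphism G H) : Prop where
  functor : i.functor.IsDense
  isMorphismOfSites : IsMorphismOfSites i.functor i.functor H.toFunctor

/-- A Cartesian full inclusion of comonads is logical if the underlying inclusion is. -/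
def IsLogical [HeytingCategory C] [HeytingCategory D] (i : ComonadMorphism G H) : Prop :=
  IsLogicalInclusion i.functor

end

end ComonadMorphism

end CoalgebraLifting

namespace CoalgebraLifting

/-! ### Images of subobjects under Cartesian functors -/

section MapSubobject

variable {C : Type u₁} [Category.{v₁} C] {D : Type u₂} [Category.{v₂} D]

/-! The forgetful functor from coalgebras is conservative, preserves finite limits and creates
colimits, so regular epimorphisms are detected on carriers. On subobjects of a coalgebra `(X, a)` it
embeds the subcoalgebras into the subobjects of the carrier, with right adjoint the interior `S ↦
a^*(G S)` (`mapSubobject_forget_le_iff`, `mapSubobject_forget_interior`). Hence unions are those of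
carriers, while `∀_f` is the interior of the `∀_f` of carriers. The cofree coalgebra functor
preserves generic monos. Since the inclusion commutes with the comonads, it commutes with interiors
and cofree coalgebras, and is therefore logical on coalgebras.

Density rests on the generic mono: a full Cartesian functor preserving one has range closed under
subobjects, up to isomorphism (`exists_iso_obj_of_mono`). With the site condition, every map `iA ⟶
X` into the carrier of a coalgebra factors through a coalgebra from the smaller category
(`exists_factorization`). A natural family of coalgebra morphisms thus induces a family on carriers,
well defined by `comp_eq_comp_of_factorizations`; density below glues it to one morphism, which is
then checked to respect the structure maps. -/

lemma le_iff_factors_arrow {X : C} (S T : Subobject X) : S ≤ T ↔ T.Factors S.arrow :=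
  ⟨fun h => Subobject.factors_of_le _ h (Subobject.factors_self S),
    fun h => Subobject.le_of_comm (T.factorThru S.arrow h) (T.factorThru_arrow _ h)⟩

lemma mapSubobject_mk (F : C ⥤ D) [PreservesFiniteLimits F] {A X : C} (m : A ⟶ X) [Mono m] :
    mapSubobject F (Subobject.mk m) = Subobject.mk (F.map m) :=
  Subobject.mk_eq_mk_of_comm _ _ (F.mapIso (Subobject.underlyingIso m)) (by
    rw [Functor.mapIso_hom, ← F.map_comp, Subobject.underlyingIso_hom_comp_eq_mk])

lemma mapSubobject_mono (F : C ⥤ D) [PreservesFiniteLimits F] {X : C} {S T : Subobject X}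
    (h : S ≤ T) : mapSubobject F S ≤ mapSubobject F T :=
  Subobject.mk_le_mk_of_comm (F.map (Subobject.ofLE S T h)) (by
    rw [← F.map_comp, Subobject.ofLE_arrow])

lemma mapSubobject_pullback [HasPullbacks C] [HasPullbacks D] (F : C ⥤ D)
    [PreservesFiniteLimits F] {X Y : C} (f : X ⟶ Y) (S : Subobject Y) :
    mapSubobject F ((Subobject.pullback f).obj S) =
      (Subobject.pullback (F.map f)).obj (mapSubobject F S) :=
  (Subobject.pullback_obj_mk ((Subobject.isPullback f S).map F)).symm

/-- A conservative functor that preserves finite limits reflects the order of subobjects. -/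
lemma mapSubobject_le_iff [HasPullbacks C] (F : C ⥤ D) [PreservesFiniteLimits F]
    [F.ReflectsIsomorphisms] {X : C} (S T : Subobject X) :
    mapSubobject F S ≤ mapSubobject F T ↔ S ≤ T := by
  refine ⟨fun h => ?_, mapSubobject_mono F⟩
  have hp := (IsPullback.of_hasPullback S.arrow T.arrow)
  have hF := hp.map F
  let k := Subobject.ofMkLEMk _ _ h
  have hk : k ≫ F.map T.arrow = F.map S.arrow := Subobject.ofMkLEMk_comp h
  let s := hF.lift (𝟙 _) k (by rw [hk, Category.id_comp])
  have hs : s ≫ F.map (pullback.fst S.arrow T.arrow) = 𝟙 _ := hF.lift_fst _ _ _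
  have : IsIso (F.map (pullback.fst S.arrow T.arrow)) :=
    ⟨s, by rw [← cancel_mono (F.map (pullback.fst S.arrow T.arrow)), Category.assoc, hs]; simp, hs⟩
  have := isIso_of_reflects_iso (pullback.fst S.arrow T.arrow) F
  exact Subobject.le_of_comm (inv (pullback.fst S.arrow T.arrow) ≫ pullback.snd S.arrow T.arrow)
    (by rw [Category.assoc, ← pullback.condition, IsIso.inv_hom_id_assoc])

lemma mapSubobject_injective [HasPullbacks C] (F : C ⥤ D) [PreservesFiniteLimits F]
    [F.ReflectsIsomorphisms] {X : C} : Function.Injective (mapSubobject F (X := X)) :=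
  fun _ _ h => le_antisymm ((mapSubobject_le_iff F _ _).1 h.le) ((mapSubobject_le_iff F _ _).1 h.ge)

/-- For an adjunction of Cartesian functors, the operation on subobjects induced by the left
adjoint has a right adjoint, given by the right adjoint followed by pullback along the unit. -/
lemma mapSubobject_le_iff_le_pullback_unit [HasPullbacks C] {L : C ⥤ D} {R : D ⥤ C} (adj : L ⊣ R)
    [PreservesFiniteLimits L] [PreservesFiniteLimits R] {X : C} (T : Subobject X)
    (S : Subobject (L.obj X)) :
    mapSubobject L T ≤ S ↔ T ≤ (Subobject.pullback (adj.unit.app X)).obj (mapSubobject R S) := by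
  rw [le_iff_factors_arrow T, Limits.pullback_factors_iff]
  constructor
  · intro h
    let k := Subobject.ofMkLE _ _ h
    have hk : k ≫ S.arrow = L.map T.arrow := Subobject.ofMkLE_arrow h
    refine (Subobject.mk_factors_iff _ _).2 ⟨adj.homEquiv _ _ k, ?_⟩
    change adj.homEquiv _ _ k ≫ R.map S.arrow = _
    rw [Adjunction.homEquiv_unit, Category.assoc, ← R.map_comp, hk]
    exact (adj.unit.naturality T.arrow).symm
  · intro h
    obtain ⟨k, hk⟩ : ∃ k : (T : C) ⟶ R.obj (S : D), k ≫ R.map S.arrow = T.arrow ≫ adj.unit.app X :=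
      (Subobject.mk_factors_iff _ _).1 h
    refine Subobject.mk_le_of_comm ((adj.homEquiv _ _).symm k) ?_
    rw [← adj.homEquiv_naturality_right_symm, hk, Adjunction.homEquiv_counit, L.map_comp,
      Category.assoc, adj.left_triangle_components, Category.comp_id]

lemma IsGenericMono.of_isPullback {T Ω T' Ω' : C} {t : T ⟶ Ω} {t' : T' ⟶ Ω'} {a : T ⟶ T'}
    {χ : Ω ⟶ Ω'} (h : IsPullback a t t' χ) (ht' : Mono t') (ht : IsGenericMono t) :
    IsGenericMono t' :=
  ⟨ht', fun _ _ m hm => by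
    obtain ⟨b, ψ, hb⟩ := ht.2 m hm
    exact ⟨_, _, hb.paste_horiz h⟩⟩

end MapSubobject

/-! ### Coalgebras of Cartesian comonads on Heyting categories -/

section Coalgebras

variable {C : Type u₁} [Category.{v₁} C] (G : Comonad C) [PreservesFiniteLimits G.toFunctor]

lemma hasFiniteLimits_coalgebra [HasFiniteLimits C] : HasFiniteLimits G.Coalgebra where
  out _ _ _ := hasLimitsOfShape_of_hasLimitsOfShape_createsLimitsOfShape G.forget

noncomputable instance preservesFiniteLimits_forget [HasFiniteLimits C] :
    PreservesFiniteLimits G.forget where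
  preservesFiniteLimits _ _ _ := inferInstance

noncomputable instance preservesFiniteLimits_cofree : PreservesFiniteLimits G.cofree :=
  have := G.adj.rightAdjoint_preservesLimits.{0, 0}
  PreservesLimitsOfSize.preservesFiniteLimits G.cofree

attribute [local instance] hasFiniteLimits_coalgebra

/-- A regular epimorphism is the coequalizer of its kernel pair; the forgetful functor preserves
kernel pairs, and both preserves and reflects coequalizers. -/
lemma isRegularEpi_forget_map_iff [Regular C] {X Y : G.Coalgebra} (f : X ⟶ Y) :
    IsRegularEpi f.f ↔ IsRegularEpi f := by
  constructor
  · intro h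
    have hk := IsKernelPair.of_hasPullback f
    have hk' : IsKernelPair f.f _ _ := hk.map G.forget
    have hc := hk'.toCoequalizer'
    exact ⟨⟨{ W := _, left := _, right := _, w := hk.w,
              isColimit := isColimitOfIsColimitCoforkMap G.forget hk.w hc }⟩⟩
  · rintro ⟨⟨h⟩⟩
    exact ⟨⟨{ W := _, left := _, right := _
              w := congrArg Comonad.Coalgebra.Hom.f h.w
              isColimit := isColimitCoforkMapOfIsColimit G.forget h.w h.isColimit }⟩⟩

lemma regular_coalgebra [Regular C] : Regular G.Coalgebra where
  hasCoequalizer_of_isKernelPair {X Y Z f g₁ g₂} h := by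
    have : HasCoequalizer (G.forget.map g₁) (G.forget.map g₂) :=
      Regular.hasCoequalizer_of_isKernelPair (h.map G.forget)
    have : HasCoequalizer ((parallelPair g₁ g₂ ⋙ G.forget).map WalkingParallelPairHom.left)
        ((parallelPair g₁ g₂ ⋙ G.forget).map WalkingParallelPairHom.right) := this
    have : HasColimit (parallelPair g₁ g₂ ⋙ G.forget) :=
      hasColimit_of_iso (diagramIsoParallelPair _)
    exact Comonad.hasColimit_of_comp_forget_hasColimit _
  regularEpiIsStableUnderBaseChange := ⟨fun {X Y Y' S f g f' g'} h hg => by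
    rw [MorphismProperty.regularEpi_iff, ← isRegularEpi_forget_map_iff] at hg ⊢
    exact Regular.regularEpiIsStableUnderBaseChange.of_isPullback (h.map G.forget) hg⟩

variable [HasFiniteLimits C]

/-- The largest subcoalgebra contained in a subobject of the carrier of a coalgebra. -/
noncomputable def interior {X : G.Coalgebra} (S : Subobject X.A) : Subobject X :=
  (Subobject.pullback (G.adj.unit.app X)).obj (mapSubobject G.cofree S)

lemma mapSubobject_forget_le_iff {X : G.Coalgebra} (T : Subobject X) (S : Subobject X.A) :
    mapSubobject G.forget T ≤ S ↔ T ≤ interior G S :=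
  mapSubobject_le_iff_le_pullback_unit G.adj T S

lemma mapSubobject_forget_interior_le {X : G.Coalgebra} (S : Subobject X.A) :
    mapSubobject G.forget (interior G S) ≤ S :=
  (mapSubobject_forget_le_iff G _ _).2 le_rfl

lemma interior_mapSubobject_forget {X : G.Coalgebra} (T : Subobject X) :
    interior G (mapSubobject G.forget T) = T :=
  le_antisymm ((mapSubobject_le_iff G.forget _ _).1 (mapSubobject_forget_interior_le G _))
    ((mapSubobject_forget_le_iff G _ _).1 le_rfl)

/-- The unit at `X` has the structure map as its carrier. This explicit form is what lets interiors
be compared along a morphism of comonads. -/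
lemma mapSubobject_forget_interior {X : G.Coalgebra} (S : Subobject X.A) :
    mapSubobject G.forget (interior G S) =
      (Subobject.pullback X.a).obj (mapSubobject G.toFunctor S) := by
  have h : (G.adj.unit.app X).f = X.a := by rw [Comonad.adj_unit]
  have := mapSubobject_pullback G.forget (G.adj.unit.app X) (mapSubobject G.cofree S)
  refine this.trans ?_
  change (Subobject.pullback (G.adj.unit.app X).f).obj _ = _
  rw [h]
  exact congrArg _ (mapSubobject_mk G.forget (G.cofree.map S.arrow))

end Coalgebras

/-! ### Unions, universal images and generic monos of coalgebras -/

section HeytingCoalgebras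

variable {C : Type u₁} [Category.{v₁} C] (G : Comonad C) [PreservesFiniteLimits G.toFunctor]

attribute [local instance] hasFiniteLimits_coalgebra

lemma mapSubobject_forget_interior_of_isBot [HasFiniteLimits C] {X : G.Coalgebra}
    {S : Subobject X.A} (h : IsBot S) : mapSubobject G.forget (interior G S) = S :=
  le_antisymm (mapSubobject_forget_interior_le G S) (h _)

lemma isBot_mapSubobject_forget_iff [HeytingCategory C] {X : G.Coalgebra} (S : Subobject X) :
    IsBot (mapSubobject G.forget S) ↔ IsBot S := by
  refine ⟨fun h T => (mapSubobject_le_iff G.forget _ _).1 (h _), fun h => ?_⟩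
  obtain ⟨B, hB⟩ := HeytingCategory.exists_isBot X.A
  intro T
  exact (mapSubobject_mono G.forget (h (interior G B))).trans
    ((mapSubobject_forget_interior_le G B).trans (hB T))

/-- A union of subcoalgebras is again one: by adjunction both lie in the interior of `U`, which is
therefore already an upper bound. -/
lemma mapSubobject_forget_interior_of_isLUB [HasFiniteLimits C] {X : G.Coalgebra}
    {S T : Subobject X} {U : Subobject X.A}
    (h : IsLUB {mapSubobject G.forget S, mapSubobject G.forget T} U) :
    mapSubobject G.forget (interior G U) = U := by
  refine le_antisymm (mapSubobject_forget_interior_le G U) (h.2 ?_)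
  rintro V (rfl | rfl)
  · exact mapSubobject_mono G.forget ((mapSubobject_forget_le_iff G _ _).1 (h.1 (Or.inl rfl)))
  · exact mapSubobject_mono G.forget ((mapSubobject_forget_le_iff G _ _).1 (h.1 (Or.inr rfl)))

lemma isLUB_of_isLUB_mapSubobject_forget [HasFiniteLimits C] {X : G.Coalgebra}
    {S T U : Subobject X} (h : IsLUB {mapSubobject G.forget S, mapSubobject G.forget T}
      (mapSubobject G.forget U)) : IsLUB {S, T} U := by
  constructor
  · rintro V (rfl | rfl)
    · exact (mapSubobject_le_iff G.forget _ _).1 (h.1 (Or.inl rfl))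
    · exact (mapSubobject_le_iff G.forget _ _).1 (h.1 (Or.inr rfl))
  · intro V hV
    refine (mapSubobject_le_iff G.forget _ _).1 (h.2 ?_)
    rintro W (rfl | rfl)
    · exact mapSubobject_mono G.forget (hV (Or.inl rfl))
    · exact mapSubobject_mono G.forget (hV (Or.inr rfl))

lemma isLUB_interior [HasFiniteLimits C] {X : G.Coalgebra}
    {S T : Subobject X} {U : Subobject X.A}
    (h : IsLUB {mapSubobject G.forget S, mapSubobject G.forget T} U) :
    IsLUB {S, T} (interior G U) :=
  isLUB_of_isLUB_mapSubobject_forget G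
    ((mapSubobject_forget_interior_of_isLUB G h).symm ▸ h)

lemma isLUB_mapSubobject_forget_iff [HeytingCategory C] {X : G.Coalgebra} (S T U : Subobject X) :
    IsLUB {mapSubobject G.forget S, mapSubobject G.forget T} (mapSubobject G.forget U) ↔
      IsLUB {S, T} U := by
  refine ⟨isLUB_of_isLUB_mapSubobject_forget G, fun h => ?_⟩
  obtain ⟨V, hV⟩ := HeytingCategory.exists_isLUB
    (mapSubobject G.forget S) (mapSubobject G.forget T)
  rw [h.unique (isLUB_interior G hV)]
  exact (mapSubobject_forget_interior_of_isLUB G hV).symm ▸ hV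

/-- Right adjoints compose: forgetting commutes with pullback, so `∀_f` for coalgebras is `∀_f` on
carriers followed by the interior. -/
lemma isForall_interior [HasFiniteLimits C] {X Y : G.Coalgebra} (f : X ⟶ Y) (S : Subobject X)
    (R : Subobject Y.A) (h : IsForall f.f (mapSubobject G.forget S) R) :
    IsForall f S (interior G R) := fun T => by
  rw [← mapSubobject_forget_le_iff, ← mapSubobject_le_iff G.forget, mapSubobject_pullback]
  exact h _

lemma IsForall.unique [HasPullbacks C] {X Y : C} {f : X ⟶ Y} {S : Subobject X}
    {R R' : Subobject Y} (h : IsForall f S R) (h' : IsForall f S R') : R = R' :=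
  le_antisymm ((h' _).1 ((h _).2 le_rfl)) ((h _).1 ((h' _).2 le_rfl))

/-- The coalgebras of a Cartesian comonad on a Heyting category form a Heyting category. -/
theorem heytingCategory_coalgebra [HeytingCategory C] : HeytingCategory G.Coalgebra where
  toRegular := regular_coalgebra G
  exists_isBot X := by
    obtain ⟨B, hB⟩ := HeytingCategory.exists_isBot X.A
    refine ⟨interior G B, (isBot_mapSubobject_forget_iff G _).1 ?_⟩
    rwa [mapSubobject_forget_interior_of_isBot G hB]
  pullback_isBot f S h := by
    rw [← isBot_mapSubobject_forget_iff] at h ⊢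
    rw [mapSubobject_pullback]
    exact HeytingCategory.pullback_isBot _ _ h
  exists_isLUB {X} S T := by
    obtain ⟨V, hV⟩ := HeytingCategory.exists_isLUB
      (mapSubobject G.forget S) (mapSubobject G.forget T)
    exact ⟨_, isLUB_interior G hV⟩
  pullback_isLUB f S T U h := by
    rw [← isLUB_mapSubobject_forget_iff] at h ⊢
    simp only [mapSubobject_pullback]
    exact HeytingCategory.pullback_isLUB _ _ _ _ h
  exists_isForall {X Y} f S := by
    obtain ⟨R, hR⟩ := HeytingCategory.exists_isForall f.f (mapSubobject G.forget S)
    exact ⟨_, isForall_interior G f S R hR⟩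

lemma isPullback_of_pullback_obj_eq [HasPullbacks C] {A B T Ω : C} {m : A ⟶ B} [Mono m]
    {t : T ⟶ Ω} [Mono t] {χ : B ⟶ Ω}
    (h : (Subobject.pullback χ).obj (Subobject.mk t) = Subobject.mk m) :
    ∃ a, IsPullback a m t χ := by
  have hp := IsPullback.of_hasPullback t χ
  rw [Subobject.pullback_obj_mk hp] at h
  exact ⟨(Subobject.isoOfMkEqMk _ _ h).inv ≫ pullback.fst t χ,
    hp.of_iso (Subobject.isoOfMkEqMk _ _ h) (Iso.refl _) (Iso.refl _) (Iso.refl _)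
    (by simp) (by simp) (by simp) (by simp)⟩

/-- The cofree functor preserves generic monomorphisms. -/
lemma isGenericMono_cofree_map [HasFiniteLimits C] {T Ω : C} {t : T ⟶ Ω} (ht : IsGenericMono t) :
    IsGenericMono (G.cofree.map t) := by
  have := ht.1
  refine ⟨inferInstance, fun A B m _ => ?_⟩
  obtain ⟨a, χ, h⟩ := ht.2 (G.forget.map m) inferInstance
  -- Classify `m` by the transpose of a classifying map of its carrier. The pullback along the
  -- transpose is the interior of the carrier of `m`, that is, `m` itself.
  refine ⟨_, G.adj.homEquiv _ _ χ, (isPullback_of_pullback_obj_eq ?_).choose_spec⟩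
  rw [Adjunction.homEquiv_unit, Subobject.pullback_comp, ← mapSubobject_mk G.cofree t,
    ← mapSubobject_pullback]
  have h' : (Subobject.pullback χ).obj (Subobject.mk t) =
      mapSubobject G.forget (Subobject.mk m) :=
    (Subobject.pullback_obj_mk h).trans (mapSubobject_mk G.forget m).symm
  rw [h']
  exact interior_mapSubobject_forget G _

theorem admitsGenericMono_coalgebra [HasFiniteLimits C] (h : AdmitsGenericMono C) :
    AdmitsGenericMono G.Coalgebra := by
  obtain ⟨T, Ω, t, ht⟩ := h
  exact ⟨_, _, _, isGenericMono_cofree_map G ht⟩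

end HeytingCoalgebras
/-! ### The functor induced on coalgebras -/

/-- The range of a full Cartesian functor that sends some generic monomorphism to a generic
monomorphism is closed under subobjects. -/
lemma exists_iso_obj_of_mono {C : Type u₁} [Category.{v₁} C] {D : Type u₂} [Category.{v₂} D]
    [HasPullbacks C] (j : C ⥤ D) [j.Full] [PreservesFiniteLimits j] {T Ω : C} {t : T ⟶ Ω}
    (ht : IsGenericMono (j.map t)) {Z : C} {P : D} (m : P ⟶ j.obj Z) (hm : Mono m) :
    ∃ (Z' : C), Nonempty (j.obj Z' ≅ P) := by
  -- By fullness the classifying map of `m` comes from `C`; pulling `t` back along it there gives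
  -- the required object.
  obtain ⟨b, χ, h⟩ := ht.2 m hm
  obtain ⟨χ, rfl⟩ := j.map_surjective χ
  exact ⟨_, ⟨((IsPullback.of_hasPullback t χ).map j).isoIsPullback _ _ h⟩⟩

namespace ComonadMorphism

variable {C : Type u₁} [Category.{v₁} C] {D : Type u₂} [Category.{v₂} D]
  {G : Comonad C} {H : Comonad D} (i : ComonadMorphism G H)

attribute [local instance] hasFiniteLimits_coalgebra

lemma IsStrict.isIso_τ {i : ComonadMorphism G H} (h : i.IsStrict) : IsIso i.τ := by
  obtain ⟨h, e⟩ := h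
  rw [e]
  infer_instance

/-- The morphism underlying a morphism of coalgebras with source in the range of `i.coalg`. -/
def carrierHom {Z : G.Coalgebra} {X : H.Coalgebra} (v : i.coalg.obj Z ⟶ X) :
    i.functor.obj Z.A ⟶ X.A := v.f

lemma carrierHom_comp {Z : G.Coalgebra} {X Y : H.Coalgebra} (v : i.coalg.obj Z ⟶ X) (f : X ⟶ Y) :
    i.carrierHom (v ≫ f) = i.carrierHom v ≫ f.f := rfl

lemma carrierHom_injective {Z : G.Coalgebra} {X : H.Coalgebra} :
    Function.Injective (i.carrierHom (Z := Z) (X := X)) :=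
  fun _ _ h => Comonad.Coalgebra.Hom.ext h

lemma carrierHom_comp_a {Z : G.Coalgebra} {X : H.Coalgebra} (v : i.coalg.obj Z ⟶ X) :
    i.carrierHom v ≫ X.a = (i.functor.map Z.a ≫ i.τ.app Z.A) ≫ H.map (i.carrierHom v) :=
  v.h.symm

lemma coalg_faithful [i.functor.Faithful] : i.coalg.Faithful where
  map_injective {X Y} f g h := by
    ext
    exact i.functor.map_injective (congrArg Comonad.Coalgebra.Hom.f h)

lemma coalg_full [i.functor.Full] [i.functor.Faithful] [IsIso i.τ] : i.coalg.Full where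
  map_surjective {A B} f := by
    obtain ⟨g, hg⟩ := i.functor.map_surjective f.f
    refine ⟨{ f := g, h := i.functor.map_injective ?_ }, by ext; exact hg⟩
    have hn : i.functor.map (G.map g) ≫ i.τ.app B.A = i.τ.app A.A ≫ H.map (i.functor.map g) :=
      i.τ.naturality g
    have hf : (i.functor.map A.a ≫ i.τ.app A.A) ≫ H.map (i.functor.map g) =
        i.functor.map g ≫ i.functor.map B.a ≫ i.τ.app B.A := hg ▸ f.h
    rw [← cancel_mono (i.τ.app B.A)]
    simp only [Functor.map_comp, Category.assoc] at hf ⊢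
    rw [← hf, ← hn]

lemma coalg_obj_injective (hi : Function.Injective i.functor.obj) [i.functor.Faithful]
    [IsIso i.τ] : Function.Injective i.coalg.obj := by
  rintro ⟨A, a, _, _⟩ ⟨B, b, _, _⟩ h
  obtain rfl : A = B := hi (congrArg Comonad.Coalgebra.A h)
  have h' : i.functor.map a ≫ i.τ.app A = i.functor.map b ≫ i.τ.app A := by
    injection h
  obtain rfl : a = b := i.functor.map_injective ((cancel_mono _).1 h')
  rfl

lemma isPullback_τ [IsIso i.τ] {X Y : C} (f : X ⟶ Y) :
    IsPullback (i.τ.app X) (i.functor.map (G.map f)) (H.map (i.functor.map f)) (i.τ.app Y) :=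
  IsPullback.of_horiz_isIso ⟨(i.τ.naturality f).symm⟩

/-- The comparison between the cofree coalgebras. -/
noncomputable def coalgCofreeIso [IsIso i.τ] (X : C) :
    i.coalg.obj (G.cofree.obj X) ≅ H.cofree.obj (i.functor.obj X) :=
  Comonad.Coalgebra.isoMk ((asIso i.τ).app X) (by
    have := i.comul X
    change (i.functor.map (G.δ.app X) ≫ i.τ.app (G.obj X)) ≫ H.map (i.τ.app X) =
      i.τ.app X ≫ H.δ.app (i.functor.obj X)
    rw [this, Category.assoc])

/-- It suffices that one generic mono, the cofree one on `t₀`, goes to a generic mono: it is a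
pullback of `t`, and this pullback is preserved. -/
lemma isGenericMono_coalg_map [HasFiniteLimits D] [PreservesFiniteLimits H.toFunctor]
    [PreservesFiniteLimits G.toFunctor] [PreservesFiniteLimits i.coalg] [IsIso i.τ] (hC : AdmitsGenericMono C)
    (hi : ∀ ⦃T Ω : C⦄ (t : T ⟶ Ω), IsGenericMono t → IsGenericMono (i.functor.map t))
    {T Ω : G.Coalgebra} {t : T ⟶ Ω} (ht : IsGenericMono t) : IsGenericMono (i.coalg.map t) := by
  obtain ⟨T₀, Ω₀, t₀, ht₀⟩ := hC
  have := ht.1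
  have := ht₀.1
  have h : IsPullback (i.coalgCofreeIso T₀).inv (H.cofree.map (i.functor.map t₀))
      (i.coalg.map (G.cofree.map t₀)) (i.coalgCofreeIso Ω₀).inv :=
    IsPullback.of_horiz_isIso ⟨by
      rw [Iso.inv_comp_eq, ← Category.assoc, Iso.eq_comp_inv]
      ext
      exact i.τ.naturality t₀⟩
  obtain ⟨a, χ, h'⟩ := ht.2 (G.cofree.map t₀) inferInstance
  exact IsGenericMono.of_isPullback (h.paste_horiz (h'.map i.coalg)) inferInstance
    (isGenericMono_cofree_map H (hi t₀ ht₀))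

/-- Under the site condition, every morphism to the carrier of a coalgebra from an object of the
smaller category factors through a morphism of coalgebras from the smaller category. -/
lemma exists_factorization [HasFiniteLimits C] [HasFiniteLimits D]
    [PreservesFiniteLimits G.toFunctor] [PreservesFiniteLimits H.toFunctor]
    [PreservesFiniteLimits i.coalg] [i.functor.Full] [i.coalg.Full] [IsIso i.τ]
    (hs : IsMorphismOfSites i.functor i.functor H.toFunctor)
    {T Ω : G.Coalgebra} {t : T ⟶ Ω} (ht : IsGenericMono (i.coalg.map t))
    {X : H.Coalgebra} {A : C} (h : i.functor.obj A ⟶ X.A) :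
    ∃ (Z : G.Coalgebra) (u : A ⟶ Z.A) (v : i.coalg.obj Z ⟶ X), h = i.functor.map u ≫ i.carrierHom v := by
  obtain ⟨B, g, k, hk⟩ := hs (h ≫ X.a)
  let η : X ⟶ H.cofree.obj X.A := { f := X.a, h := X.coassoc.symm }
  -- The carrier of `η` is the structure map, which the counit splits.
  have : Mono η := by
    have : IsSplitMono (H.forget.map η) :=
      ⟨⟨{ retraction := H.ε.app X.A, id := X.counit }⟩⟩
    exact H.forget.mono_of_mono_map inferInstance
  let σ : i.functor.obj (G.obj B) ≅ H.obj (i.functor.obj B) := (asIso i.τ).app B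
  let w : i.coalg.obj (G.cofree.obj B) ⟶ H.cofree.obj X.A :=
    (i.coalgCofreeIso B).hom ≫ H.cofree.map g
  -- The pullback of `η` along `w` is a subobject of a coalgebra from the smaller category, hence
  -- comes from there too; `h` lifts to its carrier.
  obtain ⟨Z, ⟨e⟩⟩ := exists_iso_obj_of_mono i.coalg ht (pullback.snd η w) inferInstance
  have hp : IsPullback (H.forget.map (pullback.fst η w)) (H.forget.map (pullback.snd η w))
      X.a (σ.hom ≫ H.map g) := (IsPullback.of_hasPullback η w).map H.forget
  have hkσ : h ≫ X.a = (k ≫ σ.inv) ≫ σ.hom ≫ H.map g := by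
    rw [Category.assoc, σ.inv_hom_id_assoc, hk]
  let l := hp.lift h (k ≫ σ.inv) hkσ
  obtain ⟨u, hu⟩ := i.functor.map_surjective (X := A) (Y := Z.A) (l ≫ H.forget.map e.inv)
  refine ⟨Z, u, e.hom ≫ pullback.fst η w, ?_⟩
  rw [hu]
  change h = (l ≫ H.forget.map e.inv) ≫ H.forget.map (e.hom ≫ pullback.fst η w)
  rw [Category.assoc, ← H.forget.map_comp, Iso.inv_hom_id_assoc]
  exact (hp.lift_fst _ _ _).symm

section

variable [HasFiniteLimits C] [HasFiniteLimits D] [PreservesFiniteLimits G.toFunctor]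
  [PreservesFiniteLimits H.toFunctor]

lemma preservesFiniteLimits_coalg [PreservesFiniteLimits i.functor] :
    PreservesFiniteLimits i.coalg where
  preservesFiniteLimits J _ _ := by
    have : PreservesLimitsOfShape J (i.coalg ⋙ H.forget) :=
      inferInstanceAs (PreservesLimitsOfShape J (G.forget ⋙ i.functor))
    exact preservesLimitsOfShape_of_reflects_of_preserves i.coalg H.forget

variable [PreservesFiniteLimits i.functor] [PreservesFiniteLimits i.coalg]

lemma mapSubobject_forget_coalg {X : G.Coalgebra} (S : Subobject X) :
    mapSubobject H.forget (mapSubobject i.coalg S) =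
      mapSubobject i.functor (mapSubobject G.forget S) :=
  (mapSubobject_mk H.forget (i.coalg.map S.arrow)).trans
    (mapSubobject_mk i.functor (G.forget.map S.arrow)).symm

/-- On carriers both sides are pullbacks along a structure map, which `i` preserves; `τ` being
invertible identifies `i(G S)` with `H(i S)`. -/
lemma mapSubobject_coalg_interior [IsIso i.τ] {X : G.Coalgebra} (S : Subobject X.A) :
    mapSubobject i.coalg (interior G S) =
      interior H (X := i.coalg.obj X) (mapSubobject i.functor S) := by
  refine mapSubobject_injective H.forget ?_
  rw [mapSubobject_forget_coalg, mapSubobject_forget_interior]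
  refine (mapSubobject_pullback i.functor X.a (mapSubobject G.toFunctor S)).trans
    (Eq.trans ?_ (mapSubobject_forget_interior H (X := i.coalg.obj X) _).symm)
  refine Eq.trans (congrArg _ ?_)
    (Subobject.pullback_comp (i.functor.map X.a) (i.τ.app X.A) _).symm
  refine (mapSubobject_mk i.functor (G.map S.arrow)).trans ?_
  refine Eq.trans (Subobject.pullback_obj_mk (i.isPullback_τ S.arrow)).symm (congrArg _ ?_)
  exact (mapSubobject_mk H.toFunctor (i.functor.map S.arrow)).symm

end

lemma isHeytingFunctor_coalg [HeytingCategory C] [HeytingCategory D]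
    [PreservesFiniteLimits G.toFunctor] [PreservesFiniteLimits H.toFunctor]
    [PreservesFiniteLimits i.functor] [PreservesFiniteLimits i.coalg] [IsIso i.τ]
    [HeytingCategory G.Coalgebra] [HeytingCategory H.Coalgebra]
    (h : IsHeytingFunctor i.functor) : IsHeytingFunctor i.coalg where
  map_isRegularEpi f hf :=
    (isRegularEpi_forget_map_iff H (i.coalg.map f)).1
      (h.map_isRegularEpi f.f ((isRegularEpi_forget_map_iff G f).2 hf))
  map_isBot S hS := by
    rw [← isBot_mapSubobject_forget_iff, mapSubobject_forget_coalg]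
    exact h.map_isBot _ ((isBot_mapSubobject_forget_iff G S).2 hS)
  map_isLUB S T U hU := by
    rw [← isLUB_mapSubobject_forget_iff]
    simp only [mapSubobject_forget_coalg]
    exact h.map_isLUB _ _ _ ((isLUB_mapSubobject_forget_iff G S T U).2 hU)
  map_isForall f S R hR := by
    obtain ⟨V, hV⟩ := HeytingCategory.exists_isForall f.f (mapSubobject G.forget S)
    -- Universal images are unique, so `R` may be taken to be an interior, with which `i` commutes.
    rw [hR.unique (isForall_interior G f S V hV), mapSubobject_coalg_interior]
    refine isForall_interior H _ _ _ ?_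
    rw [mapSubobject_forget_coalg]
    exact h.map_isForall _ _ _ hV

end ComonadMorphism

/-! ### Density -/

section Dense

variable {C : Type u₁} [Category.{v₁} C] {D : Type u₂} [Category.{v₂} D]

lemma hom_ext_of_isDense (F : C ⥤ D) [F.IsDense] {X Y : D} {f g : X ⟶ Y}
    (h : ∀ ⦃A : C⦄ (a : F.obj A ⟶ X), a ≫ f = a ≫ g) : f = g :=
  (F.denseAt X).hom_ext' fun _ a => by
    change 𝟙 _ ≫ a ≫ f = 𝟙 _ ≫ a ≫ g
    rw [h]

lemma exists_desc_of_isDense (F : C ⥤ D) [F.IsDense] {X Y : D}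
    (φ : ∀ ⦃A : C⦄, (F.obj A ⟶ X) → (F.obj A ⟶ Y))
    (hφ : ∀ ⦃A B : C⦄ (f : A ⟶ B) (a : F.obj B ⟶ X), φ (F.map f ≫ a) = F.map f ≫ φ a) :
    ∃ f : X ⟶ Y, ∀ ⦃A : C⦄ (a : F.obj A ⟶ X), a ≫ f = φ a := by
  let c : Cocone (CostructuredArrow.proj F X ⋙ F) :=
    { pt := Y
      ι :=
        { app a := φ a.hom
          naturality a b f := by
            have := hφ f.left b.hom
            rw [CostructuredArrow.w f] at this
            exact this.symm.trans (Category.comp_id _).symm } }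
  refine ⟨(F.denseAt X).desc c, fun A a => ?_⟩
  exact (congrArg (· ≫ (F.denseAt X).desc c) (Category.id_comp a).symm).trans
    ((F.denseAt X).fac c (CostructuredArrow.mk a))

/-- A cocone on the canonical diagram of `X` is the same as such a natural family `φ`. -/
lemma isDense_of_exists_desc (F : C ⥤ D)
    (h : ∀ (X Y : D) (φ : ∀ ⦃A : C⦄, (F.obj A ⟶ X) → (F.obj A ⟶ Y)),
      (∀ ⦃A B : C⦄ (f : A ⟶ B) (a : F.obj B ⟶ X), φ (F.map f ≫ a) = F.map f ≫ φ a) →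
      ∃! f : X ⟶ Y, ∀ ⦃A : C⦄ (a : F.obj A ⟶ X), a ≫ f = φ a) : F.IsDense where
  isDenseAt X := by
    have H (s : Cocone (CostructuredArrow.proj F X ⋙ F)) :=
      h X s.pt (fun A a => s.ι.app (CostructuredArrow.mk a)) (fun A B f a =>
        (s.w (CostructuredArrow.homMk f : CostructuredArrow.mk (F.map f ≫ a) ⟶ .mk a)).symm)
    exact ⟨{
      desc s := (H s).choose
      fac s a := by
        obtain ⟨A, ⟨⟨⟩⟩, a⟩ := a
        exact (congrArg (· ≫ (H s).choose) (Category.id_comp a)).trans ((H s).choose_spec.1 a)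
      uniq s m hm := (H s).choose_spec.2 m fun A a =>
        (congrArg (· ≫ m) (Category.id_comp a).symm).trans (hm (CostructuredArrow.mk a)) }⟩

end Dense

/-! ### Density of the induced functor -/

namespace ComonadMorphism

variable {C : Type u₁} [Category.{v₁} C] {D : Type u₂} [Category.{v₂} D]
  {G : Comonad C} {H : Comonad D} (i : ComonadMorphism G H)
  [HasFiniteLimits C] [HasFiniteLimits D] [PreservesFiniteLimits G.toFunctor]
  [PreservesFiniteLimits H.toFunctor]

attribute [local instance] hasFiniteLimits_coalgebra

/-- Two factorizations of a morphism into a coalgebra through coalgebras of the smaller category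
agree after applying a natural family of maps. -/
lemma comp_eq_comp_of_factorizations [PreservesFiniteLimits i.functor]
    [PreservesFiniteLimits i.coalg] [i.functor.Full] [i.coalg.Full]
    {T Ω : G.Coalgebra} {t : T ⟶ Ω} (ht : IsGenericMono (i.coalg.map t))
    {X Y : H.Coalgebra} (φ : ∀ ⦃Z : G.Coalgebra⦄, (i.coalg.obj Z ⟶ X) → (i.coalg.obj Z ⟶ Y))
    (hφ : ∀ ⦃Z W : G.Coalgebra⦄ (f : Z ⟶ W) (v : i.coalg.obj W ⟶ X),
      φ (i.coalg.map f ≫ v) = i.coalg.map f ≫ φ v)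
    {A : C} {Z W : G.Coalgebra} (u : A ⟶ Z.A) (v : i.coalg.obj Z ⟶ X)
    (u' : A ⟶ W.A) (v' : i.coalg.obj W ⟶ X)
    (h : i.functor.map u ≫ i.carrierHom v = i.functor.map u' ≫ i.carrierHom v') :
    i.functor.map u ≫ i.carrierHom (φ v) = i.functor.map u' ≫ i.carrierHom (φ v') := by
  have := ht.1
  -- The pullback of `v` and `v'` embeds in the image of a product, so it lies in the range up to
  -- isomorphism, and naturality of `φ` applies to its projections.
  let m : pullback v v' ⟶ i.coalg.obj (Z ⨯ W) :=
    prod.lift (pullback.fst v v') (pullback.snd v v') ≫ (PreservesLimitPair.iso i.coalg Z W).inv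
  have hm : Mono m := by
    have : Mono (prod.lift (pullback.fst v v') (pullback.snd v v')) := ⟨fun a b hab => by
      apply pullback.hom_ext
      · simpa only [Category.assoc, prod.lift_fst] using hab =≫ prod.fst
      · simpa only [Category.assoc, prod.lift_snd] using hab =≫ prod.snd⟩
    exact mono_comp _ _
  obtain ⟨Q, ⟨e⟩⟩ := exists_iso_obj_of_mono i.coalg ht m hm
  have hp : IsPullback (H.forget.map (pullback.fst v v')) (H.forget.map (pullback.snd v v'))
      (i.carrierHom v) (i.carrierHom v') := (IsPullback.of_hasPullback v v').map H.forget
  let l := hp.lift _ _ h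
  obtain ⟨p, hpp⟩ := i.coalg.map_surjective (e.hom ≫ pullback.fst v v')
  obtain ⟨q, hq⟩ := i.coalg.map_surjective (e.hom ≫ pullback.snd v v')
  have key : i.coalg.map p ≫ φ v = i.coalg.map q ≫ φ v' := by
    rw [← hφ, ← hφ, hpp, hq, Category.assoc, Category.assoc, pullback.condition]
  have key' : i.functor.map p.f ≫ i.carrierHom (φ v) = i.functor.map q.f ≫ i.carrierHom (φ v') :=
    congrArg i.carrierHom key
  let r : i.functor.obj A ⟶ i.functor.obj Q.A := l ≫ H.forget.map e.inv
  have h₁ : i.functor.map u = r ≫ i.functor.map p.f := by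
    change _ = (l ≫ H.forget.map e.inv) ≫ H.forget.map (i.coalg.map p)
    rw [hpp, Category.assoc, ← H.forget.map_comp, Iso.inv_hom_id_assoc]
    exact (hp.lift_fst _ _ _).symm
  have h₂ : i.functor.map u' = r ≫ i.functor.map q.f := by
    change _ = (l ≫ H.forget.map e.inv) ≫ H.forget.map (i.coalg.map q)
    rw [hq, Category.assoc, ← H.forget.map_comp, Iso.inv_hom_id_assoc]
    exact (hp.lift_snd _ _ _).symm
  rw [h₁, h₂, Category.assoc, Category.assoc, key']

lemma isDense_coalg [PreservesFiniteLimits i.functor]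
    [PreservesFiniteLimits i.coalg] [i.functor.Full] [i.coalg.Full] [IsIso i.τ]
    [i.functor.IsDense] (hs : IsMorphismOfSites i.functor i.functor H.toFunctor)
    {T Ω : G.Coalgebra} {t : T ⟶ Ω} (ht : IsGenericMono (i.coalg.map t)) :
    i.coalg.IsDense := by
  refine isDense_of_exists_desc _ fun X Y φ hφ => ?_
  choose Z u v huv using fun (A : C) (h : i.functor.obj A ⟶ X.A) =>
    i.exists_factorization hs ht h
  have hwd := @comp_eq_comp_of_factorizations _ _ _ _ _ _ i _ _ _ _ _ _ _ _ _ _ _ ht X Y φ hφ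
  obtain ⟨F, hF⟩ := exists_desc_of_isDense i.functor (X := X.A) (Y := Y.A)
    (fun A h => i.functor.map (u A h) ≫ i.carrierHom (φ (v A h))) (fun A B f h => by
      rw [← Functor.map_comp_assoc]
      refine hwd _ _ _ _ ?_
      rw [← huv, Functor.map_comp_assoc, ← huv])
  -- The chosen factorization of the carrier of `w` may be replaced by the trivial one, through `w`
  -- and the identity.
  have hFφ {W : G.Coalgebra} (w : i.coalg.obj W ⟶ X) :
      i.carrierHom w ≫ F = i.carrierHom (φ w) := by
    rw [hF, hwd _ _ (𝟙 _) w (by rw [← huv, i.functor.map_id, Category.id_comp]),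
      i.functor.map_id, Category.id_comp]
  -- Maps out of the carrier are tested on coalgebra morphisms alone; this yields both compatibility
  -- of `F` with the structure maps and uniqueness.
  have hX {V : D} {f g : X.A ⟶ V}
      (h : ∀ ⦃W : G.Coalgebra⦄ (w : i.coalg.obj W ⟶ X),
        i.carrierHom w ≫ f = i.carrierHom w ≫ g) : f = g :=
    hom_ext_of_isDense i.functor fun A a => by
      rw [huv A a, Category.assoc, Category.assoc, h]
  refine ⟨{ f := F, h := hX fun W w => ?_ }, fun W w => i.carrierHom_injective (hFφ w),
    fun g hg => Comonad.Coalgebra.Hom.ext (hX fun W w => ?_)⟩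
  · rw [← Category.assoc, carrierHom_comp_a, Category.assoc, ← H.map_comp, reassoc_of% hFφ w, hFφ,
      carrierHom_comp_a]
  · rw [hFφ, ← hg w, carrierHom_comp]

end ComonadMorphism

end CoalgebraLifting

theorem mainTheorem7 {C : Type u₁} [Category.{v₁} C] {D : Type u₂} [Category.{v₂} D]
    [CoalgebraLifting.HeytingCategory C] [CoalgebraLifting.HeytingCategory D]
    (hC : CoalgebraLifting.AdmitsGenericMono C) (hD : CoalgebraLifting.AdmitsGenericMono D)
    (G : Comonad C) (H : Comonad D)
    [PreservesFiniteLimits G.toFunctor] [PreservesFiniteLimits H.toFunctor]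
    (i : CoalgebraLifting.ComonadMorphism G H) (hincl : i.IsCartesianFullInclusion)
    (hdense : i.IsDense) (hlog : i.IsLogical) :
    ∃ (_ : CoalgebraLifting.HeytingCategory G.Coalgebra)
      (_ : CoalgebraLifting.HeytingCategory H.Coalgebra),
      CoalgebraLifting.AdmitsGenericMono G.Coalgebra ∧
      CoalgebraLifting.AdmitsGenericMono H.Coalgebra ∧
      CoalgebraLifting.IsCartesianFullInclusion i.coalg ∧
      i.coalg.IsDense ∧
      CoalgebraLifting.IsLogicalInclusion i.coalg := by
  have := CoalgebraLifting.heytingCategory_coalgebra G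
  have := CoalgebraLifting.heytingCategory_coalgebra H
  have := hincl.functor.full
  have := hincl.functor.faithful
  have := hincl.functor.preservesFiniteLimits
  have := hincl.isStrict.isIso_τ
  have := hdense.functor
  have := i.coalg_full
  have := i.preservesFiniteLimits_coalg
  have hgen : ∀ ⦃T Ω : G.Coalgebra⦄ (t : T ⟶ Ω), CoalgebraLifting.IsGenericMono t →
      CoalgebraLifting.IsGenericMono (i.coalg.map t) :=
    fun _ _ _ ht => i.isGenericMono_coalg_map hC hlog.map_isGenericMono ht
  have hG := CoalgebraLifting.admitsGenericMono_coalgebra G hC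
  have hi : CoalgebraLifting.IsCartesianFullInclusion i.coalg :=
    ⟨inferInstance, i.coalg_faithful, i.coalg_obj_injective hincl.functor.injective_obj,
      inferInstance⟩
  refine ⟨inferInstance, inferInstance, hG, CoalgebraLifting.admitsGenericMono_coalgebra H hD,
    hi, ?_, ⟨hi, i.isHeytingFunctor_coalg hlog.isHeytingFunctor, hgen⟩⟩
  obtain ⟨_, _, t, ht⟩ := hG
  exact i.isDense_coalg hdense.isMorphismOfSites (hgen t ht)
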